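/- An overpartition of $n$ is a partition of $n$ in which the first occurrence of each part size may be overlined; there are none if $n<0$. Let $S(i,n)$ be the number of non-overlined parts equal to $i$ in all the overpartitions of $n$, and for a sequence $a=(a_i)_{i\ge 1}$ and integers $0\le\beta<\alpha$ put $A(a,\alpha,\beta;n)=\sum_{i\ge 1}S(\alpha i-\beta,n)\,a_i$. Let $\overline{M}_k(n)$ be the number of overpartitions of $n$ in which the first (that is, smallest) part larger than $k$ exists and appears, overlined or not, at least $k+1$ times. Let $\mu$ be the Möbius function, $\omega(n)$ the number of distinct primes dividing $n$, and $\sigma_0(n)$ the number of positive divisors of $n$; a divisor $d$ of $n$ is unitary if $\gcd(d,n/d)=1$. Write $\nu(d)=(-1)^{1+d}|\mu(d)|$. Let $k\ge 1$ be an integer. Then the following hold. (1) For every integer $n$, $A(|\mu|,1,0;n)$ is the number of squarefree non-overlined parts in all the overpartitions of $n$. For every integer $n>0$, the number of unitary divisors of $n$ is $2^{\omega(n)}$, and $$(-1)^k\Big(A(|\mu|,1,0;n)+2\sum_{j=1}^k(-1)^jA(|\mu|,1,0;n-j^2)-2^{\omega(n)}\Big)=\sum_{j=1}^n 2^{\omega(j)}\,\overline{M}_k(n-j).$$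 (2) For every integer $n$, $A(\nu,1,0;n)$ is the number of squarefree non-overlined odd parts minus the number of squarefree non-overlined even parts in all the overpartitions of $n$. For every odd $n>0$, $$(-1)^k\Big(A(\nu,1,0;n)+2\sum_{j=1}^k(-1)^jA(\nu,1,0;n-j^2)-2^{\omega(n)}\Big)=\sum_{j=1}^{(n+1)/2}2^{\omega(2j-1)}\,\overline{M}_k(n-2j+1),$$ and for every even $n\ge 0$, $$(-1)^k\Big(A(\nu,1,0;n)+2\sum_{j=1}^k(-1)^jA(\nu,1,0;n-j^2)\Big)=\sum_{j=1}^{\lfloor (n+1)/2\rfloor}2^{\omega(2j-1)}\,\overline{M}_k(n-2j+1).$$ (3) For every integer $n>0$, $\sum_{d\mid n}2^{\omega(d)}=\sigma_0(n^2)$, and, with $2^\omega$ denoting the sequence $i\mapsto 2^{\omega(i)}$, $$(-1)^k\Big(A(2^{\omega},1,0;n)+2\sum_{j=1}^k(-1)^jA(2^{\omega},1,0;n-j^2)-\sigma_0(n^2)\Big)=\sum_{j=1}^n\sigma_0(j^2)\,\overline{M}_k(n-j).$$ -/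

import Mathlib

open scoped ArithmeticFunction.omega ArithmeticFunction.Moebius ArithmeticFunction.sigma

/-- An overpartition of `n`: a partition of `n` in which the first occurrence of each part size
may be overlined, i.e. a partition together with the set of those part sizes that carry an
overlined occurrence. -/
structure Overpartition (n : ℕ) where
  /-- the underlying partition, in which overlines are ignored -/
  toPartition : n.Partition
  /-- the part sizes whose first occurrence is overlined -/
  overlined : Finset ℕ
  overlined_subset : overlined ⊆ toPartition.parts.toFinset

namespace Overpartition

/-- Overpartitions as dependent pairs of a partition and a set of its part sizes. -/
def equivSigma (n : ℕ) :
    (Σ p : n.Partition, {s : Finset ℕ // s ∈ p.parts.toFinset.powerset}) ≃ Overpartition n where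
  toFun x := ⟨x.1, x.2.1, Finset.mem_powerset.mp x.2.2⟩
  invFun π := ⟨π.toPartition, π.overlined, Finset.mem_powerset.mpr π.overlined_subset⟩
  left_inv _ := rfl
  right_inv _ := rfl

instance (n : ℕ) : Fintype (Overpartition n) := Fintype.ofEquiv _ (equivSigma n)

/-- All parts of an overpartition, overlined or not, with multiplicity. -/
def parts {n : ℕ} (π : Overpartition n) : Multiset ℕ := π.toPartition.parts

/-- The non-overlined parts of an overpartition, with multiplicity: one copy of each overlined
part size is removed from the multiset of all parts. -/
def nonOverlined {n : ℕ} (π : Overpartition n) : Multiset ℕ := π.parts - π.overlined.val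

/-- The number of non-overlined parts with the property `P` in all the overpartitions of `n`;
there are no overpartitions of a negative integer. -/
def numNonOverlined (P : ℕ → Prop) [DecidablePred P] (n : ℤ) : ℕ :=
  if n < 0 then 0 else ∑ π : Overpartition n.toNat, π.nonOverlined.countP P

/-- `S(k, n)`: the number of non-overlined parts equal to `k` in all the overpartitions of `n`. -/
def S (k : ℕ) (n : ℤ) : ℕ := numNonOverlined (fun i => i = k) n

/-- `A(a, α, β; n) = ∑_{k ≥ 1} S(α k - β, n) a_k`, where `0 ≤ β < α`. Only finitely many terms
are nonzero, because `S(i, n) = 0` for `i > n`. -/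
noncomputable def A {R : Type*} [CommRing R] (a : ℕ → R) (α β : ℕ) (n : ℤ) : R :=
  ∑ᶠ (k : ℕ) (_ : 1 ≤ k), (S (α * k - β) n : R) * a k

/-- The first (that is, smallest) part larger than `k` exists and appears (overlined or not) at
least `k + 1` times. -/
def FirstLargeRepeated (k : ℕ) {n : ℕ} (π : Overpartition n) : Prop :=
  ∃ m ∈ π.parts, k < m ∧ (∀ i ∈ π.parts, k < i → m ≤ i) ∧ k + 1 ≤ π.parts.count m

instance (k n : ℕ) : DecidablePred (fun π : Overpartition n => π.FirstLargeRepeated k) :=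
  fun π => Multiset.decidableExistsMultiset
    (p := fun m => k < m ∧ (∀ i ∈ π.parts, k < i → m ≤ i) ∧ k + 1 ≤ π.parts.count m)

/-- `M̄_k(n)`: the number of overpartitions of `n` in which the first part larger than `k` appears
at least `k + 1` times. -/
def Mbar (k : ℕ) (n : ℤ) : ℕ :=
  if n < 0 then 0
  else (Finset.univ.filter (fun π : Overpartition n.toNat => π.FirstLargeRepeated k)).card

end Overpartition

/-- The unitary divisors of `n`: the divisors `d` of `n` such that `d` and `n / d` are coprime. -/
def unitaryDivisors (n : ℕ) : Finset ℕ := n.divisors.filter (fun d => Nat.Coprime d (n / d))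

/-! Everything is an identity of power series in `ℤ⟦X⟧`. Let `P` be the overpartition series
`overGenFun`. Choosing overlines gives each part size present the weight 2. The non-overlined parts
equal to `i` have series `X^i / (1 - X^i) * P`, so by Lambert summation `A a 1 0` has series `D *
P`, where `D` has coefficients `∑ d ∣ n, a d` (`mk_A_eq`). The truncated theta series `1 + 2 ∑_{j ≤
k} (-1)^j X^(j^2)` times `P` equals `1 + (-1)^k * mbarGenFun k` (`theta_mul_overGenFun`). This
follows by induction on `k` from `mbarGenFun (k+1) + mbarGenFun k = 2 X^((k+1)^2) P`. Multiplying by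
`D` and comparing coefficients gives `truncated_theta_A` for every sequence `a`. What remains is to
evaluate the divisor sums of the three sequences. -/

namespace Overpartition

open PowerSeries

/-! ### Partition generating functions and their factor at a single part. -/

/-- The factor `1 + ∑_{c ≥ 1} u c X^{a c}` of a partition generating function at the part `a`. -/
noncomputable def partFactor (u : ℕ → ℤ) {a : ℕ} (ha : a ≠ 0) : ℤ⟦X⟧ :=
  expand a ha (PowerSeries.mk fun c => if c = 0 then 1 else u c)

-- Writing the factor as the image of a series under `X ↦ X ^ a` reduces identities between factors
-- to the case `a = 1`, where coefficients are easily compared.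
open scoped PowerSeries.WithPiTopology in
theorem one_add_tsum_eq_expand {R : Type*} [CommRing R] [TopologicalSpace R] [T2Space R]
    (u : ℕ → R) {a : ℕ} (ha : a ≠ 0) :
    1 + ∑' j, u (j + 1) • (X : R⟦X⟧) ^ (a * (j + 1))
      = expand a ha (PowerSeries.mk fun c => if c = 0 then 1 else u c) := by
  have hs : Summable fun j => u (j + 1) • (X : R⟦X⟧) ^ (a * (j + 1)) :=
    Nat.Partition.summable_genFun_term' (fun _ c => u c) ha
  ext d
  rw [map_add, hs.map_tsum _ (WithPiTopology.continuous_coeff _ _)]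
  by_cases hd : a ∣ d
  · obtain ⟨c, rfl⟩ := hd
    rw [coeff_expand_mul, coeff_mk]
    rcases Nat.eq_zero_or_pos c with rfl | hc
    · simp [ha]
    · rw [tsum_eq_single (c - 1)]
      · simp [coeff_X_pow, coeff_one, ha, hc.ne', Nat.sub_add_cancel hc]
      · intro b hb
        have : c ≠ b + 1 := by omega
        simp [coeff_X_pow, ha, this]
  · rw [coeff_expand_of_not_dvd _ _ _ hd]
    have h0 : d ≠ 0 := by rintro rfl; simp at hd
    have : ∀ j, d ≠ a * (j + 1) := by rintro j rfl; simp at hd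
    simp [coeff_X_pow, coeff_one, h0, this]

open scoped PowerSeries.WithPiTopology in
/-- Two partition generating functions whose weights differ only at the part `a` differ only by
their factors at `a`. -/
theorem genFun_mul_partFactor {f g : ℕ → ℕ → ℤ} {a : ℕ} (ha : a ≠ 0)
    (h : ∀ i ≠ a, i ≠ 0 → f i = g i) :
    Nat.Partition.genFun f * partFactor (g a) ha = Nat.Partition.genFun g * partFactor (f a) ha := by
  have hf := (Nat.Partition.hasProd_genFun f).mul
    (hasProd_ite_eq (L := .unconditional ℕ) (a - 1) (partFactor (g a) ha))
  have hg := (Nat.Partition.hasProd_genFun g).mul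
    (hasProd_ite_eq (L := .unconditional ℕ) (a - 1) (partFactor (f a) ha))
  refine hf.unique ?_
  convert hg using 2 with i
  by_cases hi : i = a - 1
  · obtain rfl : a = i + 1 := by omega
    rw [one_add_tsum_eq_expand (f (i + 1)) ha, one_add_tsum_eq_expand (g (i + 1)) ha,
      if_pos hi, if_pos hi]
    exact mul_comm _ _
  · rw [if_neg hi, if_neg hi, h (i + 1) (by omega) (by omega)]

theorem partFactor_zero {a : ℕ} (ha : a ≠ 0) : partFactor (fun _ => 0) ha = 1 := by
  rw [partFactor, ← map_one (expand a ha)]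
  congr 1
  ext c
  simp [coeff_one]

theorem partFactor_two {a : ℕ} (ha : a ≠ 0) :
    (1 - X ^ a) * partFactor (fun _ => 2) ha = 1 + X ^ a := by
  have : (1 - X) * (PowerSeries.mk fun c => if c = 0 then 1 else 2 : ℤ⟦X⟧) = 1 + X := by
    ext c
    rcases c with _ | _ | c <;> simp [sub_mul, coeff_succ_X_mul, coeff_one, coeff_X]
  simpa [partFactor] using congrArg (expand a ha) this

theorem partFactor_ge {a : ℕ} (ha : a ≠ 0) (k : ℕ) :
    (1 - X ^ a) * (partFactor (fun c => if k + 1 ≤ c then 2 else 0) ha - 1)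
      = 2 * X ^ (a * (k + 1)) := by
  have : (1 - X) * ((PowerSeries.mk fun c => if c = 0 then 1 else if k + 1 ≤ c then 2 else 0 : ℤ⟦X⟧) - 1)
      = 2 * X ^ (k + 1) := by
    rw [show (2 : ℤ⟦X⟧) = C (2 : ℤ) from (map_ofNat C 2).symm]
    ext c
    rcases c with _ | c
    · simp
    · rw [coeff_C_mul, coeff_X_pow, sub_mul, map_sub, coeff_succ_X_mul]
      rcases c with _ | c
      · simp [coeff_one]
      · simp [coeff_one]
        split_ifs <;> omega
  simpa [partFactor, pow_mul, map_ofNat (expand a ha) 2] using congrArg (expand a ha) this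

/-- The weight `2c - 1 = c + (c - 1)` counts the non-overlined copies of a part of multiplicity `c`,
summed over its two overlining choices. -/
theorem partFactor_odd {a : ℕ} (ha : a ≠ 0) :
    (1 - X ^ a) * (partFactor (fun c => 2 * c - 1) ha - 1)
      = X ^ a * partFactor (fun _ => 2) ha := by
  have : (1 - X) * ((PowerSeries.mk fun c => if c = 0 then 1 else 2 * c - 1 : ℤ⟦X⟧) - 1)
      = X * (PowerSeries.mk fun c => if c = 0 then 1 else 2 : ℤ⟦X⟧) := by
    ext c
    rcases c with _ | _ | c <;> simp [sub_mul, coeff_succ_X_mul, coeff_one]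
    ring
  simpa [partFactor] using congrArg (expand a ha) this

/-! ### Recurrences for overpartitions with a gap above `k`. -/

/-- The generating function of overpartitions with no part in `(k, m]`. -/
noncomputable def avoidingGenFun (k m : ℕ) : ℤ⟦X⟧ :=
  Nat.Partition.genFun fun i _ => if k < i ∧ i ≤ m then 0 else 2

/-- The generating function of overpartitions whose first part larger than `k` is `m`, with at
least `k + 1` appearances. -/
noncomputable def firstLargeGenFun (k m : ℕ) : ℤ⟦X⟧ :=
  -- Multiplicity 0 always has weight 1, so this series also counts the overpartitions without the
  -- part `m`; the subtraction removes them.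
  Nat.Partition.genFun (fun i c => if k < i ∧ i < m then 0 else
      if i = m then (if k + 1 ≤ c then 2 else 0) else 2) - avoidingGenFun k m

/-- The generating function of overpartitions. -/
noncomputable def overGenFun : ℤ⟦X⟧ := Nat.Partition.genFun fun _ _ => 2

theorem avoidingGenFun_of_le {k m : ℕ} (h : m ≤ k) : avoidingGenFun k m = overGenFun := by
  have : ∀ i, ¬ (k < i ∧ i ≤ m) := by omega
  simp [avoidingGenFun, overGenFun, this]

theorem one_sub_X_pow_ne_zero {a : ℕ} (ha : a ≠ 0) : (1 - X ^ a : ℤ⟦X⟧) ≠ 0 := by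
  intro h
  simpa [ha] using congrArg constantCoeff h

theorem one_sub_mul_eq_of_mul_partFactor {F G : ℤ⟦X⟧} {a : ℕ} (ha : a ≠ 0)
    (h : F = G * partFactor (fun _ => 2) ha) : (1 - X ^ a) * F = (1 + X ^ a) * G := by
  linear_combination (1 - X ^ a) * h + G * partFactor_two ha

theorem one_sub_mul_avoidingGenFun {k m : ℕ} (h : k ≤ m) :
    (1 - X ^ (m + 1)) * avoidingGenFun k m = (1 + X ^ (m + 1)) * avoidingGenFun k (m + 1) := by
  refine one_sub_mul_eq_of_mul_partFactor m.add_one_ne_zero ?_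
  have := genFun_mul_partFactor m.add_one_ne_zero
    (f := fun i _ => if k < i ∧ i ≤ m then 0 else 2)
    (g := fun i _ => if k < i ∧ i ≤ m + 1 then 0 else 2)
    (fun i hi _ => funext fun _ => if_congr (by omega) rfl rfl)
  have h1 : k < m + 1 ∧ m + 1 ≤ m + 1 := by omega
  simpa [h1, partFactor_zero, avoidingGenFun, h] using this

theorem one_sub_mul_avoidingGenFun_left {k m : ℕ} (h : k + 1 ≤ m) :
    (1 - X ^ (k + 1)) * avoidingGenFun (k + 1) m = (1 + X ^ (k + 1)) * avoidingGenFun k m := by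
  refine one_sub_mul_eq_of_mul_partFactor k.add_one_ne_zero ?_
  have := genFun_mul_partFactor k.add_one_ne_zero
    (f := fun i _ => if k + 1 < i ∧ i ≤ m then 0 else 2)
    (g := fun i _ => if k < i ∧ i ≤ m then 0 else 2)
    (fun i hi _ => funext fun _ => if_congr (by omega) rfl rfl)
  simpa [partFactor_zero, avoidingGenFun, h] using this

theorem one_sub_mul_firstLargeGenFun {k m : ℕ} (h : k < m) :
    (1 - X ^ m) * firstLargeGenFun k m = 2 * X ^ (m * (k + 1)) * avoidingGenFun k m := by
  have hm : m ≠ 0 := by omega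
  have := genFun_mul_partFactor hm
    (f := fun i c => if k < i ∧ i < m then 0 else
      if i = m then (if k + 1 ≤ c then 2 else 0) else 2)
    (g := fun i _ => if k < i ∧ i ≤ m then 0 else 2)
    (fun i hi _ => funext fun _ => by simp only [hi, if_false]; exact if_congr (by omega) rfl rfl)
  simp only [lt_irrefl, and_false, if_false, if_true, h, le_refl, and_self, partFactor_zero,
    mul_one] at this
  rw [firstLargeGenFun, this, avoidingGenFun]
  linear_combination (Nat.Partition.genFun fun i _ => if k < i ∧ i ≤ m then 0 else 2)
    * partFactor_ge hm k

/-- Telescoping: the term at `m` is `avoidingGenFun 0 (m - 1) - avoidingGenFun 0 m`. -/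
theorem sum_firstLargeGenFun_zero (N : ℕ) :
    ∑ m ∈ Finset.Ioc 0 N, firstLargeGenFun 0 m = overGenFun - avoidingGenFun 0 N := by
  induction N with
  | zero => simp [avoidingGenFun_of_le]
  | succ N ih =>
    rw [Finset.sum_Ioc_succ_top (Nat.zero_le _), ih]
    apply mul_left_cancel₀ (one_sub_X_pow_ne_zero N.add_one_ne_zero)
    linear_combination one_sub_mul_firstLargeGenFun (show 0 < N + 1 by omega)
      - one_sub_mul_avoidingGenFun (Nat.zero_le N)

/-- Truncating at `N` leaves an explicit error, so induction on `N` replaces an infinite sum. The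
factor `1 + X ^ (k + 1)` clears the denominator that relates gaps above `k` to gaps above `k + 1`.
-/
theorem sum_firstLargeGenFun_add {k N : ℕ} (h : k + 1 ≤ N) :
    (1 + X ^ (k + 1)) * (∑ m ∈ Finset.Ioc (k + 1) N, firstLargeGenFun (k + 1) m
        + ∑ m ∈ Finset.Ioc k N, firstLargeGenFun k m - 2 * X ^ (k + 1) ^ 2 * overGenFun)
      = - (2 * X ^ ((k + 1) * (N + 1)) * avoidingGenFun (k + 1) N) := by
  induction N, h using Nat.le_induction with
  | base =>
    rw [Finset.Ioc_self, Finset.sum_empty, Finset.sum_Ioc_succ_top le_rfl, Finset.Ioc_self,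
      Finset.sum_empty]
    have h1 := one_sub_mul_firstLargeGenFun (show k < k + 1 by omega)
    have h2 := one_sub_mul_avoidingGenFun_left (le_refl (k + 1))
    rw [avoidingGenFun_of_le le_rfl] at *
    apply mul_left_cancel₀ (one_sub_X_pow_ne_zero k.add_one_ne_zero)
    linear_combination (1 + X ^ (k + 1)) * h1 - 2 * X ^ ((k + 1) * (k + 1)) * h2
  | succ N h ih =>
    rw [Finset.sum_Ioc_succ_top h, Finset.sum_Ioc_succ_top (by omega)]
    have h1 := one_sub_mul_firstLargeGenFun (show k < N + 1 by omega)
    have h2 := one_sub_mul_firstLargeGenFun (show k + 1 < N + 1 by omega)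
    have h3 := one_sub_mul_avoidingGenFun_left (show k + 1 ≤ N + 1 by omega)
    have h4 := one_sub_mul_avoidingGenFun h
    apply mul_left_cancel₀ (one_sub_X_pow_ne_zero N.add_one_ne_zero)
    linear_combination (1 - X ^ (N + 1)) * ih + (1 + X ^ (k + 1)) * (h1 + h2)
      - 2 * X ^ ((k + 1) * (N + 1)) * h3 - 2 * X ^ ((k + 1) * (N + 1)) * h4

/-- The error is divisible by `X ^ ((k + 1) * (N + 1))`, hence by `X ^ (N + 1)`, and `1 + X ^ (k +
1)` is a unit. -/
theorem coeff_sum_firstLargeGenFun_add {k N n : ℕ} (h : k + 1 ≤ N) (hn : n ≤ N) :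
    coeff n (∑ m ∈ Finset.Ioc (k + 1) N, firstLargeGenFun (k + 1) m)
        + coeff n (∑ m ∈ Finset.Ioc k N, firstLargeGenFun k m)
      = coeff n (2 * X ^ (k + 1) ^ 2 * overGenFun) := by
  have hu : IsUnit (1 + X ^ (k + 1) : ℤ⟦X⟧) := by
    rw [isUnit_iff_constantCoeff]; simp
  have hd : X ^ (N + 1) ∣ ∑ m ∈ Finset.Ioc (k + 1) N, firstLargeGenFun (k + 1) m
        + ∑ m ∈ Finset.Ioc k N, firstLargeGenFun k m - 2 * X ^ (k + 1) ^ 2 * overGenFun := by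
    rw [← hu.dvd_mul_left, sum_firstLargeGenFun_add h]
    exact ((pow_dvd_pow X (Nat.le_mul_of_pos_left _ k.succ_pos)).mul_left 2).mul_right _ |>.neg_right
  have := X_pow_dvd_iff.mp hd n (by omega)
  rw [map_sub, map_add] at this
  linarith

end Overpartition

/-! ### Combinatorial meaning of the series: `S` and `Mbar` as coefficients. -/

namespace Overpartition

open PowerSeries

theorem sum_eq_sum_partition {M : Type*} [AddCommMonoid M] (n : ℕ)
    (G : Multiset ℕ → Finset ℕ → M) :
    ∑ π : Overpartition n, G π.parts π.overlined
      = ∑ p : n.Partition, ∑ s ∈ p.parts.toFinset.powerset, G p.parts s := by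
  rw [← (equivSigma n).sum_comp, Fintype.sum_sigma]
  exact Finset.sum_congr rfl fun p _ => Finset.sum_coe_sort _ (G p.parts)

theorem numNonOverlined_natCast (P : ℕ → Prop) [DecidablePred P] (n : ℕ) :
    numNonOverlined P n = ∑ π : Overpartition n, π.nonOverlined.countP P :=
  if_neg (by simp)

theorem numNonOverlined_of_neg (P : ℕ → Prop) [DecidablePred P] {n : ℤ} (hn : n < 0) :
    numNonOverlined P n = 0 :=
  if_pos hn

theorem S_natCast (i n : ℕ) : S i n = ∑ π : Overpartition n, π.nonOverlined.count i := by
  rw [S, numNonOverlined_natCast]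
  simp only [Multiset.count, eq_comm]

/-- Each overlining of the other sizes extends in two ways, leaving all copies of `i` non-overlined
or all but one. -/
theorem sum_powerset_count_sub {P : Multiset ℕ} {i : ℕ} (hi : i ∈ P) :
    ∑ s ∈ P.toFinset.powerset, ((P - s.val).count i : ℤ)
      = (2 * P.count i - 1) * 2 ^ (P.toFinset.erase i).card := by
  rw [← Finset.insert_erase (Multiset.mem_toFinset.2 hi),
    Finset.sum_powerset_insert (Finset.notMem_erase i _), Finset.erase_insert_eq_erase,
    Finset.erase_idem]
  have hc : 1 ≤ P.count i := Multiset.one_le_count_iff_mem.2 hi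
  have h1 : ∀ s ∈ (P.toFinset.erase i).powerset, ((P - s.val).count i : ℤ) = P.count i := by
    intro s hs
    have : i ∉ s := fun h => Finset.notMem_erase i _ (Finset.mem_powerset.1 hs h)
    rw [Multiset.count_sub, Multiset.count_eq_zero.2 (show i ∉ s.val from this), Nat.sub_zero]
  have h2 : ∀ s ∈ (P.toFinset.erase i).powerset,
      ((P - (insert i s).val).count i : ℤ) = P.count i - 1 := by
    intro s hs
    rw [Multiset.count_sub, Multiset.count_eq_one_of_mem (insert i s).nodup (by simp)]
    push_cast [hc]
    rfl
  rw [Finset.sum_congr rfl h1, Finset.sum_congr rfl h2, Finset.sum_const, Finset.sum_const,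
    Finset.card_powerset]
  simp only [nsmul_eq_mul]
  push_cast
  ring

theorem toFinsupp_prod_eq_of_mem (P : Multiset ℕ) {i : ℕ} (hi : i ∈ P) (f : ℕ → ℕ → ℤ) :
    P.toFinsupp.prod f = f i (P.count i) * ∏ j ∈ P.toFinset.erase i, f j (P.count j) := by
  rw [Finset.mul_prod_erase _ (fun j => f j (P.count j)) (Multiset.mem_toFinset.2 hi)]
  rfl

theorem coe_S_natCast (i n : ℕ) :
    (S i n : ℤ) = coeff n (Nat.Partition.genFun (fun j c => if j = i then 2 * (c : ℤ) - 1 else 2)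
      - Nat.Partition.genFun (fun j _ => if j = i then 0 else 2)) := by
  rw [S_natCast, map_sub, Nat.Partition.coeff_genFun, Nat.Partition.coeff_genFun,
    ← Finset.sum_sub_distrib, Nat.cast_sum]
  refine (sum_eq_sum_partition n fun P s => ((P - s.val).count i : ℤ)).trans ?_
  refine Finset.sum_congr rfl fun p _ => ?_
  by_cases hi : i ∈ p.parts
  · rw [sum_powerset_count_sub hi, toFinsupp_prod_eq_of_mem _ hi, toFinsupp_prod_eq_of_mem _ hi,
      if_pos rfl, if_pos rfl, zero_mul, sub_zero, ← Finset.prod_const]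
    congr 1
    exact Finset.prod_congr rfl fun j hj => (if_neg (Finset.ne_of_mem_erase hj)).symm
  · rw [Finset.sum_eq_zero, eq_comm, sub_eq_zero]
    · refine Finset.prod_congr rfl fun j hj => ?_
      have : j ≠ i := by rintro rfl; simp at hj; exact hi hj
      simp [this]
    · intro s _
      rw [Multiset.count_sub, Multiset.count_eq_zero.2 hi, Nat.zero_sub, Nat.cast_zero]

theorem one_sub_mul_S {i : ℕ} (hi : i ≠ 0) :
    (1 - X ^ i) * PowerSeries.mk (fun n => (S i n : ℤ)) = X ^ i * overGenFun := by
  have h0 : PowerSeries.mk (fun n => (S i n : ℤ))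
      = Nat.Partition.genFun (fun j c => if j = i then 2 * (c : ℤ) - 1 else 2)
        - Nat.Partition.genFun (fun j _ => if j = i then 0 else 2) := by
    ext n
    rw [coeff_mk, coe_S_natCast]
  have h1 := genFun_mul_partFactor hi (f := fun j c => if j = i then 2 * (c : ℤ) - 1 else 2)
    (g := fun j _ => if j = i then 0 else 2)
    (fun j hj _ => funext fun c => by simp only [if_neg hj])
  have h2 := genFun_mul_partFactor hi (f := fun _ _ => 2)
    (g := fun j _ => if j = i then 0 else 2)
    (fun j hj _ => funext fun c => by simp only [if_neg hj])
  simp only [if_true, partFactor_zero, mul_one] at h1 h2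
  rw [h0, h1, overGenFun, h2]
  linear_combination (Nat.Partition.genFun fun j _ => if j = i then 0 else 2) * partFactor_odd hi

theorem Mbar_natCast (k n : ℕ) :
    Mbar k n = (Finset.univ.filter fun π : Overpartition n => π.FirstLargeRepeated k).card :=
  if_neg (by simp)

/-- `m` is the smallest element of `P` larger than `k`, and it appears at least `k + 1` times. -/
def IsFirstLarge (k m : ℕ) (P : Multiset ℕ) : Prop :=
  m ∈ P ∧ k < m ∧ (∀ i ∈ P, k < i → m ≤ i) ∧ k + 1 ≤ P.count m

-- The two products cancel unless `m` is the first part above `k`: with a part strictly between `k`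
-- and `m` both vanish, and without the part `m` they agree. If `m` is that part, the subtracted
-- product vanishes.
open scoped Classical in
theorem coeff_firstLargeGenFun {k m : ℕ} (h : k < m) (n : ℕ) :
    coeff n (firstLargeGenFun k m)
      = ∑ p : n.Partition, if IsFirstLarge k m p.parts then (2 : ℤ) ^ p.parts.toFinset.card else 0
    := by
  rw [firstLargeGenFun, avoidingGenFun, map_sub, Nat.Partition.coeff_genFun,
    Nat.Partition.coeff_genFun, ← Finset.sum_sub_distrib]
  refine Finset.sum_congr rfl fun p _ => ?_
  by_cases hj : ∃ j ∈ p.parts, k < j ∧ j < m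
  · obtain ⟨j, hjp, hkj, hjm⟩ := hj
    have hn : ¬ IsFirstLarge k m p.parts := fun hf => absurd (hf.2.2.1 j hjp hkj) (by omega)
    rw [toFinsupp_prod_eq_of_mem _ hjp, toFinsupp_prod_eq_of_mem _ hjp, if_neg hn]
    simp [hkj, hjm, hjm.le]
  · push Not at hj
    by_cases hm : m ∈ p.parts
    · rw [toFinsupp_prod_eq_of_mem _ hm, toFinsupp_prod_eq_of_mem _ hm]
      have hf : IsFirstLarge k m p.parts ↔ k + 1 ≤ p.parts.count m :=
        ⟨fun hf => hf.2.2.2, fun hc => ⟨hm, h, hj, hc⟩⟩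
      have hprod : ∀ j ∈ p.parts.toFinset.erase m, (if k < j ∧ j < m then 0 else
          if j = m then (if k + 1 ≤ p.parts.count j then 2 else 0) else 2 : ℤ) = 2 := by
        intro j hj'
        have hj1 : j ∈ p.parts := Multiset.mem_toFinset.1 (Finset.mem_of_mem_erase hj')
        have hj2 : ¬ (k < j ∧ j < m) := fun h' => absurd (hj j hj1 h'.1) (by omega)
        rw [if_neg hj2, if_neg (Finset.ne_of_mem_erase hj')]
      rw [Finset.prod_congr rfl hprod, Finset.prod_const,
        Finset.card_erase_of_mem (Multiset.mem_toFinset.2 hm)]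
      have hpos : 0 < p.parts.toFinset.card :=
        Finset.card_pos.2 ⟨m, Multiset.mem_toFinset.2 hm⟩
      simp only [lt_irrefl, and_false, if_false, if_true, h, le_refl, and_self, zero_mul, sub_zero,
        hf]
      split_ifs
      · rw [← pow_succ', Nat.sub_add_cancel hpos]
      · simp
    · have hn : ¬ IsFirstLarge k m p.parts := fun hf => hm hf.1
      rw [if_neg hn, sub_eq_zero]
      refine Finset.prod_congr rfl fun j hj' => ?_
      have hj1 : j ∈ p.parts := by simpa using hj'
      have hjm : j ≠ m := by rintro rfl; exact hm hj1
      simp only [hjm, if_false]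
      exact if_congr (by omega) rfl rfl

/-- The first large part is unique and at most `n`, so any cutoff `N ≥ n` counts each overpartition
once. -/
theorem coe_Mbar_natCast {k n N : ℕ} (hN : n ≤ N) :
    (Mbar k n : ℤ) = coeff n (∑ m ∈ Finset.Ioc k N, firstLargeGenFun k m) := by
  classical
  rw [map_sum, Finset.sum_congr rfl fun m hm =>
    coeff_firstLargeGenFun (Finset.mem_Ioc.1 hm).1 n, Finset.sum_comm, Mbar_natCast,
    Finset.card_filter, Nat.cast_sum]
  have h := sum_eq_sum_partition n fun P _ => if ∃ m, IsFirstLarge k m P then (1 : ℤ) else 0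
  have h' : ∀ π : Overpartition n, π.FirstLargeRepeated k ↔ ∃ m, IsFirstLarge k m π.parts :=
    fun π => Iff.rfl
  simp only [h', Nat.cast_ite, Nat.cast_one, Nat.cast_zero]
  rw [h]
  refine Finset.sum_congr rfl fun p _ => ?_
  rw [Finset.sum_const, Finset.card_powerset]
  by_cases hm : ∃ m, IsFirstLarge k m p.parts
  · rw [if_pos hm]
    obtain ⟨m, hm⟩ := hm
    rw [Finset.sum_eq_single m, if_pos hm]
    · simp
    · intro b _ hb
      refine if_neg fun hb' => hb ?_
      exact le_antisymm (hb'.2.2.1 m hm.1 hm.2.1) (hm.2.2.1 b hb'.1 hb'.2.1)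
    · intro hm'
      exact absurd (Finset.mem_Ioc.2 ⟨hm.2.1, (Nat.Partition.le_of_mem_parts hm.1).trans hN⟩) hm'
  · rw [if_neg hm, smul_zero]
    exact (Finset.sum_eq_zero fun m _ => if_neg fun h => hm ⟨m, h⟩).symm

/-! ### The truncated theta identity. -/

/-- The generating function of `Mbar k`. -/
noncomputable def mbarGenFun (k : ℕ) : ℤ⟦X⟧ := PowerSeries.mk fun n => (Mbar k n : ℤ)

theorem mbarGenFun_zero : mbarGenFun 0 = overGenFun - 1 := by
  ext n
  rw [mbarGenFun, coeff_mk, coe_Mbar_natCast le_rfl, sum_firstLargeGenFun_zero, map_sub, map_sub]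
  congr 1
  rw [avoidingGenFun, Nat.Partition.coeff_genFun, coeff_one]
  rcases Nat.eq_zero_or_pos n with rfl | hn
  · simp
  · rw [if_neg hn.ne']
    refine Finset.sum_eq_zero fun p _ => ?_
    obtain ⟨i, hi⟩ : ∃ i, i ∈ p.parts := by
      refine Multiset.exists_mem_of_ne_zero fun h => ?_
      have := p.parts_sum
      rw [h, Multiset.sum_zero] at this
      omega
    rw [toFinsupp_prod_eq_of_mem _ hi, if_pos ⟨p.parts_pos hi, Nat.Partition.le_of_mem_parts hi⟩,
      zero_mul]

theorem mbarGenFun_succ_add (k : ℕ) :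
    mbarGenFun (k + 1) + mbarGenFun k = 2 * X ^ (k + 1) ^ 2 * overGenFun := by
  ext n
  -- One cutoff must serve both `k` and `k + 1`, and be at least `k + 1`.
  have hn : n ≤ n + k + 1 := by omega
  rw [map_add, mbarGenFun, mbarGenFun, coeff_mk, coeff_mk, coe_Mbar_natCast hn,
    coe_Mbar_natCast hn, coeff_sum_firstLargeGenFun_add (by omega) hn]

/-- The truncated theta identity for overpartitions. -/
theorem theta_mul_overGenFun (k : ℕ) :
    (1 + 2 * ∑ j ∈ Finset.Icc 1 k, (-1) ^ j * X ^ j ^ 2) * overGenFun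
      = 1 + (-1) ^ k * mbarGenFun k := by
  induction k with
  | zero => simp [mbarGenFun_zero]
  | succ k ih =>
    rw [Finset.sum_Icc_succ_top (by omega)]
    linear_combination ih - (-1) ^ (k + 1) * mbarGenFun_succ_add k

/-! ### The sums `A` as Lambert series times the overpartition series. -/

theorem A_one_zero_natCast (a : ℕ → ℤ) {n N : ℕ} (hN : n ≤ N) :
    A a 1 0 n = ∑ i ∈ Finset.Icc 1 N, (S i n : ℤ) * a i := by
  rw [A]
  have h0 : ∀ i, n < i → S i n = 0 := by
    intro i hi
    rw [S_natCast]
    refine Finset.sum_eq_zero fun π _ => Multiset.count_eq_zero.2 fun h => ?_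
    have := Nat.Partition.le_of_mem_parts (Multiset.mem_of_le (Multiset.sub_le_self _ _) h)
    omega
  simp only [one_mul, Nat.sub_zero]
  refine finsum_cond_eq_sum_of_cond_iff _ fun {i} hi => ?_
  have : ¬ n < i := fun h => hi (by rw [h0 i h, Nat.cast_zero, zero_mul])
  rw [Finset.mem_Icc]
  omega

theorem A_of_neg (a : ℕ → ℤ) (α β : ℕ) {n : ℤ} (hn : n < 0) : A a α β n = 0 := by
  simp [A, S, numNonOverlined_of_neg _ hn]

theorem A_one_zero_indicator (P : ℕ → Prop) [DecidablePred P] (h0 : ¬ P 0) (n : ℤ) :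
    A (fun i => if P i then (1 : ℤ) else 0) 1 0 n = numNonOverlined P n := by
  rcases lt_or_ge n 0 with hn | hn
  · rw [A_of_neg _ _ _ hn, numNonOverlined_of_neg _ hn, Nat.cast_zero]
  · lift n to ℕ using hn
    rw [A_one_zero_natCast _ le_rfl, numNonOverlined_natCast]
    simp only [mul_ite, mul_one, mul_zero, ← Finset.sum_filter, S_natCast, Nat.cast_sum]
    rw [Finset.sum_comm]
    refine Finset.sum_congr rfl fun π _ => ?_
    rw [Multiset.countP_eq_card_filter, ← Multiset.sum_count_eq_card
      (s := (Finset.Icc 1 n).filter P), Nat.cast_sum]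
    · refine Finset.sum_congr rfl fun i hi => ?_
      rw [Multiset.count_filter_of_pos (Finset.mem_filter.1 hi).2]
    · intro i hi
      obtain ⟨hi, hP⟩ := Multiset.mem_filter.1 hi
      have := Nat.Partition.le_of_mem_parts (Multiset.mem_of_le (Multiset.sub_le_self _ _) hi)
      rw [Finset.mem_filter, Finset.mem_Icc]
      exact ⟨⟨Nat.one_le_iff_ne_zero.2 fun h => h0 (h ▸ hP), this⟩, hP⟩

theorem mk_A_eq (a : ℕ → ℤ) :
    PowerSeries.mk (fun n => A a 1 0 n)
      = PowerSeries.mk (fun n => ∑ d ∈ n.divisors, a d) * overGenFun := by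
  -- This is the geometric series of `X ^ i / (1 - X ^ i)`: the exponents are the positive multiples
  -- of `i`.
  have hD : ∀ i : ℕ, i ≠ 0 → PowerSeries.mk (fun n => (S i n : ℤ))
      = PowerSeries.mk (fun n => if i ∣ n ∧ n ≠ 0 then (1 : ℤ) else 0) * overGenFun := by
    intro i hi
    apply mul_left_cancel₀ (one_sub_X_pow_ne_zero hi)
    rw [one_sub_mul_S hi, ← mul_assoc]
    congr 1
    ext n
    rw [sub_mul, one_mul, map_sub, coeff_X_pow, coeff_X_pow_mul', coeff_mk]
    rcases lt_trichotomy n i with h | h | h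
    · have : ¬ (i ∣ n ∧ n ≠ 0) := fun h' => absurd (Nat.le_of_dvd (by omega) h'.1) (by omega)
      rw [if_neg h.ne, if_neg this, if_neg (by omega), sub_zero]
    · subst h
      simp [hi]
    · have h1 : n ≠ 0 := by omega
      have h2 : n - i ≠ 0 := by omega
      have h3 : i ∣ n - i ↔ i ∣ n :=
        ⟨fun h' => Nat.sub_add_cancel h.le ▸ Nat.dvd_add h' dvd_rfl,
          fun h' => Nat.dvd_sub h' dvd_rfl⟩
      rw [if_neg h.ne', if_pos h.le, coeff_mk]
      simp [h1, h2, h3]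
  ext n
  rw [coeff_mk, A_one_zero_natCast a le_rfl, coeff_mul]
  have h1 : ∀ i ∈ Finset.Icc 1 n, (S i n : ℤ) * a i
      = ∑ x ∈ Finset.HasAntidiagonal.antidiagonal n,
        (if i ∣ x.1 ∧ x.1 ≠ 0 then a i else 0) * coeff x.2 overGenFun := by
    intro i hi
    have := congrArg (coeff n) (hD i (by simp at hi; omega))
    rw [coeff_mk, coeff_mul] at this
    rw [this, Finset.sum_mul]
    refine Finset.sum_congr rfl fun x _ => ?_
    rw [coeff_mk]
    split_ifs <;> ring
  rw [Finset.sum_congr rfl h1, Finset.sum_comm]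
  refine Finset.sum_congr rfl fun x hx => ?_
  rw [← Finset.sum_mul, coeff_mk, ← Finset.sum_filter]
  congr 1
  refine Finset.sum_congr ?_ fun _ _ => rfl
  ext i
  have := Finset.HasAntidiagonal.mem_antidiagonal.1 hx
  simp only [Finset.mem_filter, Finset.mem_Icc, Nat.mem_divisors]
  constructor
  · exact fun h => h.2
  · exact fun h => ⟨⟨Nat.pos_of_dvd_of_pos h.1 (by omega), (Nat.le_of_dvd (by omega) h.1).trans (by omega)⟩, h⟩

theorem truncated_theta_A (a : ℕ → ℤ) (k n : ℕ) :
    (-1 : ℤ) ^ k * (A a 1 0 n + 2 * ∑ j ∈ Finset.Icc 1 k,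
        (-1) ^ j * A a 1 0 ((n : ℤ) - (j : ℤ) ^ 2) - ∑ d ∈ n.divisors, a d)
      = ∑ j ∈ Finset.Icc 1 n,
          (∑ d ∈ j.divisors, a d) * (Mbar k ((n : ℤ) - (j : ℤ)) : ℤ) := by
  have key : PowerSeries.mk (fun n => A a 1 0 n)
        * (1 + C 2 * ∑ j ∈ Finset.Icc 1 k, C ((-1) ^ j) * X ^ j ^ 2)
      = PowerSeries.mk (fun n => ∑ d ∈ n.divisors, a d)
        + C ((-1) ^ k) * (PowerSeries.mk (fun n => ∑ d ∈ n.divisors, a d) * mbarGenFun k) := by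
    have := theta_mul_overGenFun k
    simp only [map_pow, map_neg, map_one, map_ofNat]
    rw [mk_A_eq]
    linear_combination PowerSeries.mk (fun n => ∑ d ∈ n.divisors, a d) * this
  have h1 : ∀ j : ℕ, coeff n (PowerSeries.mk (fun n => A a 1 0 n) * X ^ j ^ 2)
      = A a 1 0 ((n : ℤ) - (j : ℤ) ^ 2) := by
    intro j
    rw [coeff_mul_X_pow']
    split_ifs with h
    · rw [coeff_mk]; push_cast [h]; rfl
    · rw [A_of_neg]
      have : (n : ℤ) < (j : ℤ) ^ 2 := by exact_mod_cast not_le.1 h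
      omega
  have h2 : coeff n (PowerSeries.mk (fun n => ∑ d ∈ n.divisors, a d) * mbarGenFun k)
      = ∑ j ∈ Finset.Icc 1 n,
          (∑ d ∈ j.divisors, a d) * (Mbar k ((n : ℤ) - (j : ℤ)) : ℤ) := by
    rw [coeff_mul, Finset.Nat.sum_antidiagonal_eq_sum_range_succ_mk, Finset.sum_range_succ',
      Finset.range_eq_Ico, Finset.sum_Ico_add' (fun j =>
        coeff j (PowerSeries.mk fun n => ∑ d ∈ n.divisors, a d) * coeff (n - j) (mbarGenFun k)) 0 n 1]
    -- The term `j = 0` drops out because `Nat.divisors 0` is empty.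
    simp only [coeff_mk, Nat.divisors_zero, Finset.sum_empty, zero_mul, add_zero, mbarGenFun]
    refine Finset.sum_congr rfl fun j hj => ?_
    rw [Nat.cast_sub (by simp at hj; omega)]
  have h3 := congrArg (coeff n) key
  rw [mul_add, mul_one, map_add, map_add, coeff_C_mul, h2, coeff_mk, coeff_mk, mul_left_comm,
    coeff_C_mul, Finset.mul_sum, map_sum] at h3
  simp only [mul_left_comm _ (C _), coeff_C_mul, h1] at h3
  rw [h3, add_sub_cancel_left, ← mul_assoc, ← mul_pow]
  simp

end Overpartition

/-! ### Divisor sums of the three sequences. -/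

theorem card_squarefree_divisors {n : ℕ} (hn : n ≠ 0) :
    (n.divisors.filter Squarefree).card = 2 ^ ω n := by
  rw [Finset.card_eq_sum_ones, Nat.sum_divisors_filter_squarefree hn, ← Finset.card_eq_sum_ones,
    Finset.card_powerset, Nat.factors_eq]
  rfl

theorem sum_abs_moebius {n : ℕ} (hn : n ≠ 0) : ∑ d ∈ n.divisors, |μ d| = 2 ^ ω n := by
  simp_rw [ArithmeticFunction.abs_moebius, ← Finset.sum_filter, Finset.sum_const,
    card_squarefree_divisors hn]
  simp

theorem factorization_of_mem_unitaryDivisors {n d : ℕ} (hd : d ∈ unitaryDivisors n) {p : ℕ}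
    (hp : p ∈ d.primeFactors) : d.factorization p = n.factorization p := by
  simp only [unitaryDivisors, Finset.mem_filter, Nat.mem_divisors] at hd
  obtain ⟨⟨⟨e, rfl⟩, hn⟩, hc⟩ := hd
  have hd0 : 0 < d := Nat.pos_of_ne_zero (left_ne_zero_of_mul hn)
  rw [Nat.mul_div_cancel_left e hd0] at hc
  rw [Nat.factorization_mul_of_coprime hc, Finsupp.add_apply,
    Nat.factorization_eq_zero_of_not_dvd (n := e), add_zero]
  intro he
  have hp' := Nat.prime_of_mem_primeFactors hp
  exact hp'.one_lt.ne' (Nat.eq_one_of_dvd_coprimes hc (Nat.dvd_of_mem_primeFactors hp) he)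

/-- A unitary divisor contains each of its primes to the full power occurring in `n`, so it
corresponds to a subset of the primes of `n`. -/
theorem card_unitaryDivisors {n : ℕ} (hn : n ≠ 0) : (unitaryDivisors n).card = 2 ^ ω n := by
  have hω : ω n = n.primeFactors.card := rfl
  rw [hω, ← Finset.card_powerset]
  refine Finset.card_nbij Nat.primeFactors ?_ ?_ ?_
  · intro d hd
    simp only [unitaryDivisors, Finset.mem_filter, Nat.mem_divisors, Finset.mem_coe] at hd
    simpa using Nat.primeFactors_mono hd.1.1 hn
  · intro d hd e he hde
    have hd0 : d ≠ 0 := by rintro rfl; simp [unitaryDivisors] at hd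
    have he0 : e ≠ 0 := by rintro rfl; simp [unitaryDivisors] at he
    refine Nat.eq_of_factorization_eq hd0 he0 fun p => ?_
    by_cases hp : p ∈ d.primeFactors
    · rw [factorization_of_mem_unitaryDivisors hd hp,
        factorization_of_mem_unitaryDivisors he (hde ▸ hp)]
    · have hp' : p ∉ e.primeFactors := fun h => hp (by rw [hde]; exact h)
      rw [← Nat.support_factorization, Finsupp.notMem_support_iff] at hp hp'
      rw [hp, hp']
  · intro s hs
    replace hs : s ⊆ n.primeFactors := by simpa using hs
    have hprime : ∀ t ⊆ n.primeFactors, (∏ p ∈ t, p ^ n.factorization p).primeFactors = t := by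
      intro t ht
      ext q
      constructor
      · intro hq
        obtain ⟨p, hp, hqp⟩ := (Prime.dvd_finsetProd_iff
          (Nat.prime_of_mem_primeFactors hq).prime _).1 (Nat.dvd_of_mem_primeFactors hq)
        have := (Nat.prime_dvd_prime_iff_eq (Nat.prime_of_mem_primeFactors hq)
          (Nat.prime_of_mem_primeFactors (ht hp))).1
          ((Nat.prime_of_mem_primeFactors hq).dvd_of_dvd_pow hqp)
        exact this ▸ hp
      · intro hq
        have hq' := Nat.prime_of_mem_primeFactors (ht hq)
        rw [Nat.mem_primeFactors]
        refine ⟨hq', ?_, Finset.prod_ne_zero_iff.2 fun p hp =>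
          pow_ne_zero _ (Nat.prime_of_mem_primeFactors (ht hp)).ne_zero⟩
        have h1 : n.factorization q ≠ 0 :=
          Finsupp.mem_support_iff.1 (by rw [Nat.support_factorization]; exact ht hq)
        exact (dvd_pow_self q h1).trans (Finset.dvd_prod_of_mem _ hq)
    refine ⟨∏ p ∈ s, p ^ n.factorization p, ?_, hprime s hs⟩
    have hmul : (∏ p ∈ s, p ^ n.factorization p)
        * ∏ p ∈ n.primeFactors \ s, p ^ n.factorization p = n := by
      rw [mul_comm, Finset.prod_sdiff hs]
      exact Nat.prod_factorization_pow_eq_self hn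
    have hpos : 0 < ∏ p ∈ s, p ^ n.factorization p :=
      Nat.pos_of_ne_zero fun h => hn (by rw [← hmul, h, zero_mul])
    have hpos' : ∏ p ∈ n.primeFactors \ s, p ^ n.factorization p ≠ 0 :=
      fun h => hn (by rw [← hmul, h, mul_zero])
    simp only [unitaryDivisors, Finset.coe_filter, Set.mem_ofPred_eq, Nat.mem_divisors]
    refine ⟨⟨⟨_, hmul.symm⟩, hn⟩, ?_⟩
    rw [Nat.div_eq_of_eq_mul_right hpos hmul.symm, ← Nat.disjoint_primeFactors hpos.ne' hpos',
      hprime s hs, hprime _ Finset.sdiff_subset]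
    exact Finset.disjoint_sdiff

theorem sum_two_pow_omega_prime_pow {p : ℕ} (hp : p.Prime) (e : ℕ) :
    ∑ d ∈ (p ^ e).divisors, 2 ^ ω d = 2 * e + 1 := by
  rw [Nat.divisors_prime_pow hp, Finset.sum_map, Finset.sum_range_succ']
  simp [ArithmeticFunction.cardDistinctFactors_apply_prime_pow hp, mul_comm]

/-- Both sides are multiplicative and equal `2e + 1` at `p ^ e`. -/
theorem sum_two_pow_omega {n : ℕ} (hn : n ≠ 0) :
    ∑ d ∈ n.divisors, 2 ^ ω d = σ 0 (n ^ 2) := by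
  induction n using Nat.recOnPosPrimePosCoprime with
  | zero => exact absurd rfl hn
  | one => simp
  | prime_pow p e hp he =>
    rw [sum_two_pow_omega_prime_pow hp, ← pow_mul,
      ArithmeticFunction.sigma_zero_apply_prime_pow hp, mul_comm]
  | coprime a b ha hb hab iha ihb =>
    have hf : ((ArithmeticFunction.prodPrimeFactors fun _ => 2) * ArithmeticFunction.zeta :
        ArithmeticFunction ℕ).IsMultiplicative :=
      (ArithmeticFunction.IsMultiplicative.prodPrimeFactors _).mul
        ArithmeticFunction.isMultiplicative_zeta
    have hsum : ∀ m : ℕ, ((ArithmeticFunction.prodPrimeFactors fun _ => 2) * ArithmeticFunction.zeta :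
        ArithmeticFunction ℕ) m = ∑ d ∈ m.divisors, 2 ^ ω d := by
      intro m
      rw [ArithmeticFunction.mul_zeta_apply]
      refine Finset.sum_congr rfl fun d hd => ?_
      rw [ArithmeticFunction.prodPrimeFactors_apply (Nat.pos_of_mem_divisors hd).ne',
        Finset.prod_const]
      rfl
    rw [mul_pow, ArithmeticFunction.isMultiplicative_sigma.map_mul_of_coprime (hab.pow 2 2),
      ← iha (by omega), ← ihb (by omega), ← hsum, ← hsum, ← hsum, hf.map_mul_of_coprime hab]

theorem sum_neg_one_pow_mul_abs_moebius_of_odd {n : ℕ} (hn : Odd n) :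
    ∑ d ∈ n.divisors, (-1 : ℤ) ^ (1 + d) * |μ d| = 2 ^ ω n := by
  rw [← sum_abs_moebius hn.pos.ne']
  refine Finset.sum_congr rfl fun d hd => ?_
  have : Odd d := hn.of_dvd_nat (Nat.dvd_of_mem_divisors hd)
  rw [(odd_one.add_odd this).neg_one_pow, one_mul]

theorem sum_neg_one_pow_mul_abs_moebius_of_even {n : ℕ} (hn : Even n) :
    ∑ d ∈ n.divisors, (-1 : ℤ) ^ (1 + d) * |μ d| = 0 := by
  have h1 : ∀ d, (-1 : ℤ) ^ (1 + d) * |μ d| = if Squarefree d then (-1 : ℤ) ^ (1 + d) else 0 := by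
    intro d
    rw [ArithmeticFunction.abs_moebius, mul_ite, mul_one, mul_zero]
  simp_rw [h1, ← Finset.sum_filter]
  have h2 : ∀ m, Odd m → Nat.Coprime 2 m := fun m hm => Nat.coprime_two_left.2 hm
  have h3 : ∀ m, Squarefree (2 * m) → Odd m := by
    intro m hm
    by_contra h
    obtain ⟨r, rfl⟩ := Nat.not_odd_iff_even.1 h
    simpa using hm 2 ⟨r, by ring⟩
  -- For even `n`, the pairing `d ↔ 2d` with `d` odd matches squarefree divisors of opposite sign.
  refine Finset.sum_involution (fun d _ => if Odd d then 2 * d else d / 2) ?_ ?_ ?_ ?_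
  · intro d hd
    simp only [Finset.mem_filter] at hd
    split_ifs with h
    · rw [(odd_one.add_odd h).neg_one_pow, (odd_one.add_even (even_two_mul d)).neg_one_pow]
      simp
    · obtain ⟨m, rfl⟩ := even_iff_two_dvd.1 (Nat.not_odd_iff_even.1 h)
      rw [Nat.mul_div_cancel_left m two_pos, (odd_one.add_odd (h3 m hd.2)).neg_one_pow,
        (odd_one.add_even (even_two_mul m)).neg_one_pow]
      simp
  · intro d hd _
    have := Nat.pos_of_mem_divisors (Finset.mem_filter.1 hd).1
    split_ifs with h <;> omega
  · intro d hd
    simp only [Finset.mem_filter, Nat.mem_divisors] at hd ⊢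
    obtain ⟨⟨hdn, hn0⟩, hs⟩ := hd
    split_ifs with h
    · exact ⟨⟨(h2 d h).mul_dvd_of_dvd_of_dvd hn.two_dvd hdn, hn0⟩,
        (Nat.squarefree_mul (h2 d h)).2 ⟨Nat.prime_two.squarefree, hs⟩⟩
    · obtain ⟨m, rfl⟩ := even_iff_two_dvd.1 (Nat.not_odd_iff_even.1 h)
      rw [Nat.mul_div_cancel_left m two_pos]
      exact ⟨⟨(dvd_mul_left m 2).trans hdn, hn0⟩, hs.squarefree_of_dvd (dvd_mul_left m 2)⟩
  · intro d hd
    simp only [Finset.mem_filter] at hd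
    by_cases h : Odd d
    · simp [h]
    · obtain ⟨m, rfl⟩ := even_iff_two_dvd.1 (Nat.not_odd_iff_even.1 h)
      simp only [if_neg h, Nat.mul_div_cancel_left m two_pos, if_pos (h3 m hd.2)]

theorem sum_Icc_one_eq_sum_odd {f : ℕ → ℤ} (hf : ∀ j, Even j → f j = 0) (n : ℕ) :
    ∑ j ∈ Finset.Icc 1 n, f j = ∑ j ∈ Finset.Icc 1 ((n + 1) / 2), f (2 * j - 1) := by
  rw [← Finset.sum_filter_of_ne (p := Odd) fun j _ hj =>
    Nat.not_even_iff_odd.1 fun h => hj (hf j h)]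
  refine (Finset.sum_nbij (fun j => 2 * j - 1) ?_ ?_ ?_ fun _ _ => rfl).symm
  · intro j hj
    simp only [Finset.mem_Icc, Finset.mem_filter] at hj ⊢
    exact ⟨by omega, j - 1, by omega⟩
  · intro i hi j hj hij
    simp only [Finset.coe_Icc, Set.mem_Icc] at hi hj hij
    omega
  · intro j hj
    simp only [Finset.coe_filter, Finset.mem_Icc, Set.mem_ofPred_eq] at hj
    obtain ⟨hj, r, rfl⟩ := hj
    exact ⟨r + 1, by simp only [Finset.coe_Icc, Set.mem_Icc]; omega, by simp only; omega⟩

/-! ### Specialization to the Möbius sequences and conclusion. -/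

namespace Overpartition

theorem A_abs_moebius (n : ℤ) :
    A (fun d => |μ d|) 1 0 n = (numNonOverlined Squarefree n : ℤ) := by
  simp_rw [ArithmeticFunction.abs_moebius]
  exact A_one_zero_indicator Squarefree not_squarefree_zero n

theorem A_sub (a b : ℕ → ℤ) (n : ℤ) :
    A (fun d => a d - b d) 1 0 n = A a 1 0 n - A b 1 0 n := by
  rcases lt_or_ge n 0 with hn | hn
  · simp_rw [A_of_neg _ _ _ hn, sub_zero]
  · lift n to ℕ using hn
    simp_rw [A_one_zero_natCast _ le_rfl, mul_sub, Finset.sum_sub_distrib]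

theorem A_neg_one_pow_mul_abs_moebius (n : ℤ) :
    A (fun d => (-1 : ℤ) ^ (1 + d) * |μ d|) 1 0 n
      = (numNonOverlined (fun i => Squarefree i ∧ Odd i) n : ℤ)
        - (numNonOverlined (fun i => Squarefree i ∧ Even i) n : ℤ) := by
  rw [← A_one_zero_indicator _ (by simp), ← A_one_zero_indicator _ (by simp), ← A_sub]
  congr 1
  funext d
  rw [ArithmeticFunction.abs_moebius]
  by_cases hs : Squarefree d
  · rcases Nat.even_or_odd d with h | h
    · simp [hs, h, Nat.not_odd_iff_even.2 h, (odd_one.add_even h).neg_one_pow]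
    · simp [hs, h, Nat.not_even_iff_odd.2 h, (odd_one.add_odd h).neg_one_pow]
  · simp [hs]

/-- The divisor sum is left unevaluated so that both parities of `n` are covered; on the right, even
indices contribute zero. -/
theorem truncated_theta_A_signed_moebius (k n : ℕ) :
    (-1 : ℤ) ^ k * (A (fun d => (-1 : ℤ) ^ (1 + d) * |μ d|) 1 0 n
        + 2 * ∑ j ∈ Finset.Icc 1 k, (-1) ^ j
            * A (fun d => (-1 : ℤ) ^ (1 + d) * |μ d|) 1 0 ((n : ℤ) - (j : ℤ) ^ 2)
        - ∑ d ∈ n.divisors, (-1 : ℤ) ^ (1 + d) * |μ d|)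
      = ∑ j ∈ Finset.Icc 1 ((n + 1) / 2),
          2 ^ ω (2 * j - 1) * (Mbar k ((n : ℤ) - 2 * (j : ℤ) + 1) : ℤ) := by
  rw [truncated_theta_A, sum_Icc_one_eq_sum_odd]
  · refine Finset.sum_congr rfl fun j hj => ?_
    have hj1 := (Finset.mem_Icc.1 hj).1
    rw [sum_neg_one_pow_mul_abs_moebius_of_odd ⟨j - 1, by omega⟩]
    congr 3
    push_cast [show 1 ≤ 2 * j by omega]
    ring
  · intro j hj
    rw [sum_neg_one_pow_mul_abs_moebius_of_even hj, zero_mul]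

end Overpartition

theorem mainTheorem8 (k : ℕ) (hk : 0 < k) :
    -- squarefree non-overlined parts and unitary divisors
    ((∀ n : ℤ, Overpartition.A (fun d => |μ d|) 1 0 n
        = (Overpartition.numNonOverlined Squarefree n : ℤ)) ∧
      ∀ n : ℕ, 0 < n →
        (unitaryDivisors n).card = 2 ^ ω n ∧
        (-1 : ℤ) ^ k * (Overpartition.A (fun d => |μ d|) 1 0 n
            + 2 * ∑ j ∈ Finset.Icc 1 k,
                (-1) ^ j * Overpartition.A (fun d => |μ d|) 1 0 ((n : ℤ) - (j : ℤ) ^ 2)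
            - 2 ^ ω n)
          = ∑ j ∈ Finset.Icc 1 n, 2 ^ ω j * (Overpartition.Mbar k ((n : ℤ) - (j : ℤ)) : ℤ)) ∧
    -- odd minus even squarefree non-overlined parts
    ((∀ n : ℤ, Overpartition.A (fun d => (-1 : ℤ) ^ (1 + d) * |μ d|) 1 0 n
        = (Overpartition.numNonOverlined (fun i => Squarefree i ∧ Odd i) n : ℤ)
          - (Overpartition.numNonOverlined (fun i => Squarefree i ∧ Even i) n : ℤ)) ∧
      (∀ n : ℕ, Odd n →
        (-1 : ℤ) ^ k * (Overpartition.A (fun d => (-1 : ℤ) ^ (1 + d) * |μ d|) 1 0 n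
            + 2 * ∑ j ∈ Finset.Icc 1 k, (-1) ^ j
                * Overpartition.A (fun d => (-1 : ℤ) ^ (1 + d) * |μ d|) 1 0 ((n : ℤ) - (j : ℤ) ^ 2)
            - 2 ^ ω n)
          = ∑ j ∈ Finset.Icc 1 ((n + 1) / 2),
              2 ^ ω (2 * j - 1) * (Overpartition.Mbar k ((n : ℤ) - 2 * (j : ℤ) + 1) : ℤ)) ∧
      (∀ n : ℕ, Even n →
        (-1 : ℤ) ^ k * (Overpartition.A (fun d => (-1 : ℤ) ^ (1 + d) * |μ d|) 1 0 n
            + 2 * ∑ j ∈ Finset.Icc 1 k, (-1) ^ j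
                * Overpartition.A (fun d => (-1 : ℤ) ^ (1 + d) * |μ d|) 1 0 ((n : ℤ) - (j : ℤ) ^ 2))
          = ∑ j ∈ Finset.Icc 1 ((n + 1) / 2),
              2 ^ ω (2 * j - 1) * (Overpartition.Mbar k ((n : ℤ) - 2 * (j : ℤ) + 1) : ℤ))) ∧
    -- the version for the number of divisors of a square
    (∀ n : ℕ, 0 < n →
        ∑ d ∈ n.divisors, 2 ^ ω d = σ 0 (n ^ 2) ∧
        (-1 : ℤ) ^ k * (Overpartition.A (fun d => (2 : ℤ) ^ ω d) 1 0 n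
            + 2 * ∑ j ∈ Finset.Icc 1 k,
                (-1) ^ j * Overpartition.A (fun d => (2 : ℤ) ^ ω d) 1 0 ((n : ℤ) - (j : ℤ) ^ 2)
            - (σ 0 (n ^ 2) : ℤ))
          = ∑ j ∈ Finset.Icc 1 n,
              (σ 0 (j ^ 2) : ℤ) * (Overpartition.Mbar k ((n : ℤ) - (j : ℤ)) : ℤ)) := by
  refine ⟨⟨Overpartition.A_abs_moebius, fun n hn => ⟨card_unitaryDivisors hn.ne', ?_⟩⟩,
    ⟨Overpartition.A_neg_one_pow_mul_abs_moebius, fun n hn => ?_, fun n hn => ?_⟩,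
    fun n hn => ⟨sum_two_pow_omega hn.ne', ?_⟩⟩
  · rw [← sum_abs_moebius hn.ne', Overpartition.truncated_theta_A]
    refine Finset.sum_congr rfl fun j hj => ?_
    rw [sum_abs_moebius (Nat.one_le_iff_ne_zero.1 (Finset.mem_Icc.1 hj).1)]
  · rw [← Overpartition.truncated_theta_A_signed_moebius,
      sum_neg_one_pow_mul_abs_moebius_of_odd hn]
  · rw [← Overpartition.truncated_theta_A_signed_moebius,
      sum_neg_one_pow_mul_abs_moebius_of_even hn, sub_zero]
  · have h : ∀ m : ℕ, 0 < m → ∑ d ∈ m.divisors, (2 : ℤ) ^ ω d = (σ 0 (m ^ 2) : ℤ) := by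
      intro m hm
      rw [← sum_two_pow_omega hm.ne']
      push_cast
      rfl
    rw [← h n hn, Overpartition.truncated_theta_A]
    refine Finset.sum_congr rfl fun j hj => ?_
    rw [h j (Finset.mem_Icc.1 hj).1]
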